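/- Let $R$ be a commutative ring with identity and let $M$ be an $R$-module. Write $Z(M)=\{r\in R : rx=0 \text{ for some } 0\neq x\in M\}$ for the set of zero-divisors of $M$, so that $Z(R)$ is the set of zero-divisors of $R$, let $\mathrm{Reg}(R)=R\setminus Z(R)$ be the set of regular elements of $R$, and let $\mathrm{Jac}(R)$ be the Jacobson radical of $R$. A commutative ring is called a Prüfer ring if every nonzero finitely generated ideal containing a regular element is projective. Let $R\ltimes M$ be the trivial extension of $R$ by $M$, that is, the abelian group $R\oplus M$ with multiplication $(r,x)(s,y)=(rs,\,ry+sx)$. Assume that $Z(M)\subseteq Z(R)$. 1. If $R\ltimes M$ is a Prüfer ring, then $R$ is a Prüfer ring and $M_{\mathfrak m}=rM_{\mathfrak m}$ for every maximal ideal $\mathfrak m$ of $R$ and every $r\in\mathrm{Reg}(R)$. 2. Assume further that $Z(R)\subseteq\mathrm{Jac}(R)$. If $R$ is a Prüfer ring and $M_{\mathfrak m}=rM_{\mathfrak m}$ for every maximal ideal $\mathfrak m$ of $R$ and every $r\in\mathrm{Reg}(R)$, then $R\ltimes M$ is a Prüfer ring. -/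

import Mathlib

open scoped Pointwise

/-- The set `Z(M)` of zero-divisors of an `R`-module `M`: the scalars that annihilate
some nonzero element of `M`. For `M = R` this is the set of zero-divisors of the ring `R`. -/
def moduleZeroDivisors (R M : Type*) [CommRing R] [AddCommGroup M] [Module R M] : Set R :=
  {r | ∃ x : M, x ≠ 0 ∧ r • x = 0}

/-- A regular ideal is one that contains a regular element (an element that is not a
zero-divisor). -/
def IsRegularIdeal {R : Type*} [CommRing R] (I : Ideal R) : Prop :=
  ∃ r ∈ I, r ∈ nonZeroDivisors R

/-- A Prüfer ring (possibly with zero-divisors): every nonzero finitely generated regular ideal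
is projective as a module. -/
def IsPruferRing (R : Type*) [CommRing R] : Prop :=
  ∀ I : Ideal R, I ≠ ⊥ → I.FG → IsRegularIdeal I → Module.Projective R I

/-- `M_𝔪 = r M_𝔪` for every maximal ideal `𝔪` of `R` and every regular element `r` of `R`,
as `R_𝔪`-submodules of the localization `M_𝔪`. -/
def IsLocallyRegularDivisible (R M : Type*) [CommRing R] [AddCommGroup M] [Module R M] : Prop :=
  ∀ (𝔪 : Ideal R) [𝔪.IsMaximal], ∀ r ∈ nonZeroDivisors R,
    (⊤ : Submodule (Localization.AtPrime 𝔪) (LocalizedModule 𝔪.primeCompl M)) = r • ⊤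

/-! For an ideal `I` containing a regular `a`, projectivity means `I * K = (a)` for some `K`. Such
an equation survives ring maps, so it passes between `R` and `R ⋉ M` along `inlHom` and `fstHom`.
The local condition on `M` amounts to `rM = M` for all regular `r`. Under it every regular ideal of
`R ⋉ M` contains `0 ⊕ M`, hence is extended from `R`; conversely, invertibility of `((r,0), (0,m))`
forces `m ∈ rM`. -/

section InvertibleIdeal

variable {R : Type*} [CommRing R]

/-- `K` is the colon ideal `(a) : I`. It contains the coordinates `s a i` of a dual basis, since `x
* s a i = a * s x i`, and `a = ∑ i * s a i`. -/
theorem Ideal.exists_mul_eq_span_singleton_of_projective {I : Ideal R} [Module.Projective R I]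
    {a : R} (ha : a ∈ I) : ∃ K : Ideal R, I * K = Ideal.span {a} := by
  obtain ⟨s, hs⟩ := Module.projective_def'.mp ‹Module.Projective R I›
  refine ⟨{ carrier := {c | ∀ x ∈ I, a ∣ x * c}
            zero_mem' := fun x _ => by simp
            add_mem' := fun hc hd x hx => by rw [mul_add]; exact dvd_add (hc x hx) (hd x hx)
            smul_mem' := fun r c hc x hx => by
              rw [smul_eq_mul, mul_left_comm]; exact (hc x hx).mul_left r }, le_antisymm ?_ ?_⟩
  · exact Ideal.mul_le.mpr fun x hx c hc => Ideal.mem_span_singleton.mpr (hc x hx)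
  · rw [Ideal.span_singleton_le_iff_mem]
    have h : ((s ⟨a, ha⟩).sum fun i c => c * (i : R)) = a := by
      have := congrArg (Subtype.val : I → R) (LinearMap.congr_fun hs ⟨a, ha⟩)
      simpa [Finsupp.linearCombination_apply, Finsupp.sum] using this
    refine Set.mem_of_eq_of_mem h.symm (Ideal.sum_mem _ fun i _ => ?_)
    simp only [mul_comm _ (i : R)]
    refine Ideal.mul_mem_mul i.2 fun x hx => ⟨s ⟨x, hx⟩ i, ?_⟩
    have hxa : x • (⟨a, ha⟩ : I) = a • ⟨x, hx⟩ := Subtype.ext (mul_comm x a)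
    have := congrArg (fun v => s v i) hxa
    simpa only [map_smul, Finsupp.smul_apply, smul_eq_mul] using this

theorem Ideal.projective_of_mul_eq_span_singleton {I K : Ideal R} {a : R}
    (ha : a ∈ nonZeroDivisors R) (h : I * K = Ideal.span {a}) : Module.Projective R I := by
  have cancel : ∀ {x y : R}, a * x = a * y → x = y := (mul_cancel_left_mem_nonZeroDivisors ha).mp
  -- Splitting up to the factor `z / a`, which is additive in `z`; for `z = i * k` use `x ↦ (x * k /
  -- a) · i`. Taking `z = a` gives a true splitting.
  have key : ∀ z ∈ I * K, ∃ s : I →ₗ[R] I →₀ R,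
      ∀ x : I, a • Finsupp.linearCombination R id (s x) = z • x := by
    intro z hz
    induction hz using Submodule.mul_induction_on' with
    | mem_mul_mem i hi k hk =>
      have hdvd : ∀ x : I, ∃ q, (x : R) * k = a * q := fun x =>
        Ideal.mem_span_singleton.mp (h ▸ Ideal.mul_mem_mul x.2 hk)
      choose q hq using hdvd
      let f : I →ₗ[R] R :=
        { toFun := q
          map_add' := fun x y => cancel (by
            rw [mul_add, ← hq, ← hq, ← hq, Submodule.coe_add, add_mul])
          map_smul' := fun r x => cancel (by
            rw [RingHom.id_apply, smul_eq_mul, mul_left_comm, ← hq, ← hq, Submodule.coe_smul,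
              smul_eq_mul, mul_assoc]) }
      refine ⟨Finsupp.lsingle ⟨i, hi⟩ ∘ₗ f, fun x => Subtype.ext ?_⟩
      have : f x = q x := rfl
      simp only [LinearMap.comp_apply, Finsupp.lsingle_apply, Finsupp.linearCombination_single,
        Submodule.coe_smul, smul_eq_mul, id, this]
      rw [← mul_assoc, ← hq]
      ring
    | add y _ z _ hy hz =>
      obtain ⟨s, hs⟩ := hy
      obtain ⟨t, ht⟩ := hz
      exact ⟨s + t, fun x => by rw [LinearMap.add_apply, map_add, smul_add, hs, ht, add_smul]⟩
  obtain ⟨s, hs⟩ := key a (h ▸ Ideal.mem_span_singleton_self a)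
  refine Module.projective_def'.mpr ⟨s, LinearMap.ext fun x => Subtype.ext (cancel ?_)⟩
  exact congrArg Subtype.val (hs x)

end InvertibleIdeal

section RegularDivisible

variable {R M : Type*} [CommRing R] [AddCommGroup M] [Module R M]

theorem notMem_moduleZeroDivisors_of_mem_nonZeroDivisors {r : R} (hr : r ∈ nonZeroDivisors R) :
    r ∉ moduleZeroDivisors R R := by
  rintro ⟨x, hx, hrx⟩
  exact hx ((mul_left_mem_nonZeroDivisors_eq_zero_iff hr).mp hrx)

theorem isLocallyRegularDivisible_iff : IsLocallyRegularDivisible R M ↔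
    ∀ r ∈ nonZeroDivisors R, ∀ m : M, ∃ y : M, r • y = m := by
  constructor
  · intro h r hr m
    -- The conductor of `m` into `rM`; the local hypothesis keeps it out of every maximal ideal.
    let A : Ideal R := (LinearMap.range (LinearMap.lsmul R M r)).comap
      (LinearMap.toSpanSingleton R M m)
    suffices hA : A = ⊤ by
      have h1 : (1 : R) ∈ A := hA ▸ Submodule.mem_top
      simpa [A] using h1
    by_contra hA
    obtain ⟨P, hP, hAP⟩ := Ideal.exists_le_maximal A hA
    have hm : LocalizedModule.mk m (1 : P.primeCompl) ∈
        r • (⊤ : Submodule (Localization.AtPrime P) (LocalizedModule P.primeCompl M)) :=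
      h P r hr ▸ Submodule.mem_top
    obtain ⟨w, -, hw⟩ := (Submodule.mem_smul_pointwise_iff_exists _ _ _).mp hm
    induction w using LocalizedModule.induction_on with
    | h y t =>
      rw [LocalizedModule.smul'_mk, LocalizedModule.mk_eq] at hw
      obtain ⟨u, hu⟩ := hw
      refine (u * t).2 (hAP (?_ : ((u * t : P.primeCompl) : R) ∈ A))
      refine ⟨(u : R) • y, ?_⟩
      simp only [Submonoid.smul_def, one_smul, smul_smul, LinearMap.lsmul_apply,
        LinearMap.toSpanSingleton_apply, Submonoid.coe_mul] at hu ⊢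
      rw [mul_comm, hu]
  · intro h P _ r hr
    refine (eq_top_iff.mpr fun w _ => ?_).symm
    induction w using LocalizedModule.induction_on with
    | h m t =>
      obtain ⟨y, rfl⟩ := h r hr m
      rw [← LocalizedModule.smul'_mk]
      exact Submodule.smul_mem_pointwise_smul _ _ _ Submodule.mem_top

end RegularDivisible

namespace TrivSqZeroExt

variable {R M : Type*} [CommRing R] [AddCommGroup M] [Module R M] [Module Rᵐᵒᵖ M]
  [IsCentralScalar R M]

theorem inl_mem_nonZeroDivisors (hZ : moduleZeroDivisors R M ⊆ moduleZeroDivisors R R) {r : R}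
    (hr : r ∈ nonZeroDivisors R) : (inl r : TrivSqZeroExt R M) ∈ nonZeroDivisors _ := by
  refine mem_nonZeroDivisors_iff_left.mpr fun z hz => ?_
  have h1 : r * z.fst = 0 := by simpa using congrArg fst hz
  have h2 : r • z.snd = 0 := by simpa using congrArg snd hz
  refine ext ((mul_left_mem_nonZeroDivisors_eq_zero_iff hr).mp h1) ?_
  by_contra hne
  exact notMem_moduleZeroDivisors_of_mem_nonZeroDivisors hr (hZ ⟨_, hne, h2⟩)

theorem fst_mem_nonZeroDivisors {z : TrivSqZeroExt R M} (hz : z ∈ nonZeroDivisors _) :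
    z.fst ∈ nonZeroDivisors R := by
  refine mem_nonZeroDivisors_iff_left.mpr fun s hs => ?_
  have hsm : ∀ m : M, s • m = 0 := fun m => by
    have : z * inr (s • m) = 0 := by
      ext <;> simp [smul_smul, mul_comm s, hs]
    simpa using congrArg snd ((mul_left_mem_nonZeroDivisors_eq_zero_iff hz).mp this)
  have : z * inl s = 0 := by
    ext <;> simp [hs, hsm]
  simpa using congrArg fst ((mul_left_mem_nonZeroDivisors_eq_zero_iff hz).mp this)

theorem map_fst_map_inl (I : Ideal R) :
    (I.map (inlHom R M)).map (fstHom R R M).toRingHom = I := by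
  rw [Ideal.map_map]
  exact Ideal.map_id I

/-- Both ideals contain `0 ⊕ M`, because `(0, z.fst • y) = z * (0, y)`, so only first coordinates
matter. -/
theorem map_inl_map_fst {J : Ideal (TrivSqZeroExt R M)} {z : TrivSqZeroExt R M} (hz : z ∈ J)
    (hdiv : ∀ m : M, ∃ y : M, z.fst • y = m) :
    (J.map (fstHom R R M).toRingHom).map (inlHom R M) = J := by
  have hJ : ∀ m : M, (inr m : TrivSqZeroExt R M) ∈ J := fun m => by
    obtain ⟨y, rfl⟩ := hdiv m
    have : (inr (z.fst • y) : TrivSqZeroExt R M) = z * inr y := by ext <;> simp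
    exact this ▸ J.mul_mem_right _ hz
  have hI : ∀ m : M,
      (inr m : TrivSqZeroExt R M) ∈ (J.map (fstHom R R M).toRingHom).map (inlHom R M) :=
    fun m => by
      obtain ⟨y, rfl⟩ := hdiv m
      have : (inr (z.fst • y) : TrivSqZeroExt R M) = inlHom R M (fstHom R R M z) * inr y := by
        ext <;> simp
      exact this ▸ Ideal.mul_mem_right _ _
        (Ideal.mem_map_of_mem _ (Ideal.mem_map_of_mem (fstHom R R M).toRingHom hz))
  refine le_antisymm ?_ fun w hw => ?_
  · rw [Ideal.map_map, Ideal.map_le_iff_le_comap]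
    intro w hw
    have : (inl w.fst : TrivSqZeroExt R M) = w - inr w.snd := by ext <;> simp
    exact (this ▸ J.sub_mem hw (hJ _) : (inl w.fst : TrivSqZeroExt R M) ∈ J)
  · rw [← inl_fst_add_inr_snd_eq w]
    exact Ideal.add_mem _
      (Ideal.mem_map_of_mem (inlHom R M) (Ideal.mem_map_of_mem (fstHom R R M).toRingHom hw)) (hI _)

theorem exists_smul_eq_of_isPruferRing (hS : IsPruferRing (TrivSqZeroExt R M))
    (hZ : moduleZeroDivisors R M ⊆ moduleZeroDivisors R R) {r : R} (hr : r ∈ nonZeroDivisors R)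
    (m : M) : ∃ y : M, r • y = m := by
  by_cases hm : m = 0
  · exact ⟨0, by simp [hm]⟩
  let J : Ideal (TrivSqZeroExt R M) := Ideal.span {inl r, inr m}
  have hrJ : inl r ∈ J := Ideal.subset_span (by simp)
  have hmJ : inr m ∈ J := Ideal.subset_span (by simp)
  have hJ : J ≠ ⊥ := fun h => hm (by
    simpa using congrArg snd (show (inr m : TrivSqZeroExt R M) = 0 from (h ▸ hmJ :)))
  have := hS J hJ (Submodule.fg_span (Set.toFinite _)) ⟨_, hrJ, inl_mem_nonZeroDivisors hZ hr⟩
  obtain ⟨K, hK⟩ := Ideal.exists_mul_eq_span_singleton_of_projective hrJ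
  have hd : ∀ c ∈ K, inl r ∣ inr m * c := fun c hc =>
    Ideal.mem_span_singleton.mp (hK ▸ Ideal.mul_mem_mul hmJ hc)
  -- First coordinates force `c.fst = 1`, so `(0, m) * c = (0, m)`, which `(r, 0)` divides.
  obtain ⟨c, hc, d, -, hcd⟩ : ∃ c ∈ K, ∃ d ∈ K, inl r * c + inr m * d = inl r := by
    have h : inl r ∈ J * K := hK ▸ Ideal.mem_span_singleton_self _
    rw [show J = _ from Ideal.span_insert _ _, Ideal.sup_mul] at h
    obtain ⟨x, hx, y, hy, hxy⟩ := Submodule.mem_sup.mp h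
    obtain ⟨c, hc, rfl⟩ := Ideal.mem_span_singleton_mul.mp hx
    obtain ⟨d, hd, rfl⟩ := Ideal.mem_span_singleton_mul.mp hy
    exact ⟨c, hc, d, hd, hxy⟩
  have hc1 : c.fst = 1 := by
    have : r * c.fst = r * 1 := by simpa using congrArg fst hcd
    exact (mul_cancel_left_mem_nonZeroDivisors hr).mp this
  obtain ⟨w, hw⟩ := hd c hc
  refine ⟨w.snd, ?_⟩
  simpa [hc1] using (congrArg snd hw).symm

theorem isPruferRing_of_isPruferRing (hS : IsPruferRing (TrivSqZeroExt R M))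
    (hZ : moduleZeroDivisors R M ⊆ moduleZeroDivisors R R) : IsPruferRing R := by
  rintro I hI hfg ⟨a, ha, hreg⟩
  have haJ : inl a ∈ I.map (inlHom R M) := Ideal.mem_map_of_mem (inlHom R M) ha
  have hJ : I.map (inlHom R M) ≠ ⊥ := fun h => hI (by
    rw [← map_fst_map_inl (M := M) I, h, Ideal.map_bot])
  have := hS _ hJ (hfg.map _) ⟨_, haJ, inl_mem_nonZeroDivisors hZ hreg⟩
  obtain ⟨K, hK⟩ := Ideal.exists_mul_eq_span_singleton_of_projective haJ
  refine Ideal.projective_of_mul_eq_span_singleton (K := K.map (fstHom R R M).toRingHom) hreg ?_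
  have := congrArg (Ideal.map (fstHom R R M).toRingHom) hK
  rw [Ideal.map_mul, map_fst_map_inl, Ideal.map_span, Set.image_singleton] at this
  exact this

theorem isPruferRing (hR : IsPruferRing R)
    (hZ : moduleZeroDivisors R M ⊆ moduleZeroDivisors R R)
    (hdiv : ∀ r ∈ nonZeroDivisors R, ∀ m : M, ∃ y : M, r • y = m) :
    IsPruferRing (TrivSqZeroExt R M) := by
  rintro J hJ hfg ⟨z, hz, hreg⟩
  have ha := fst_mem_nonZeroDivisors hreg
  have hIJ := map_inl_map_fst hz (hdiv _ ha)
  have haI : z.fst ∈ J.map (fstHom R R M).toRingHom :=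
    Ideal.mem_map_of_mem (fstHom R R M).toRingHom hz
  have hI : J.map (fstHom R R M).toRingHom ≠ ⊥ := fun h => hJ (by
    rw [← hIJ, h, Ideal.map_bot])
  have := hR _ hI (hfg.map _) ⟨_, haI, ha⟩
  obtain ⟨K, hK⟩ := Ideal.exists_mul_eq_span_singleton_of_projective haI
  refine Ideal.projective_of_mul_eq_span_singleton (K := K.map (inlHom R M))
    (inl_mem_nonZeroDivisors hZ ha) ?_
  have := congrArg (Ideal.map (inlHom R M)) hK
  rw [Ideal.map_mul, hIJ, Ideal.map_span, Set.image_singleton] at this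
  exact this

end TrivSqZeroExt

/- `TrivSqZeroExt R M` is the trivial extension `R ⋉ M`. Mathlib asks for the right action of `R`
on `M` explicitly; `IsCentralScalar R M` says that it is the given action, as for every module
over a commutative ring. -/
theorem mainTheorem3 {R : Type*} {M : Type*} [CommRing R] [AddCommGroup M] [Module R M]
    [Module Rᵐᵒᵖ M] [IsCentralScalar R M]
    (hZ : moduleZeroDivisors R M ⊆ moduleZeroDivisors R R) :
    (IsPruferRing (TrivSqZeroExt R M) → IsPruferRing R ∧ IsLocallyRegularDivisible R M) ∧
    (moduleZeroDivisors R R ⊆ (Ring.jacobson R : Set R) →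
      IsPruferRing R → IsLocallyRegularDivisible R M → IsPruferRing (TrivSqZeroExt R M)) :=
  ⟨fun hS => ⟨TrivSqZeroExt.isPruferRing_of_isPruferRing hS hZ,
    isLocallyRegularDivisible_iff.mpr fun _ hr m =>
      TrivSqZeroExt.exists_smul_eq_of_isPruferRing hS hZ hr m⟩,
  fun _ hR hM => TrivSqZeroExt.isPruferRing hR hZ (isLocallyRegularDivisible_iff.mp hM)⟩
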